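/- **Proposition (Tightness of the random-reset estimator).** Let $\mathcal{Y}=\{y_0,y_1,\dots,y_{|\mathcal{Y}|-1}\}$ be a finite action set with $|\mathcal{Y}|\ge 2$, and let $R_{\max},\tau,\varepsilon,p_\pi$ be real numbers with $$0<p_\pi\le 1,\qquad 0<\tau\le R_{\max}/2,\qquad 0\le\varepsilon<\tau,\qquad (1-p_\pi)\,\varepsilon\le \tau\,p_\pi .$$ Consider the finite-horizon MDP with horizon $H=1$, states $x_1,x_2$, initial distribution $\mu(x_1)=p_\pi$, $\mu(x_2)=1-p_\pi$ (the transition kernel is arbitrary, since $H=1$), and deterministic rewards $$r(x,y_k)=\tfrac{R_{\max}}2\ (k\ne 1),\qquad r(x_1,y_1)=\tfrac{R_{\max}}2+\tau,\qquad r(x_2,y_1)=\tfrac{R_{\max}}2+\varepsilon .$$ Let $\pi$ be the policy that always plays $y_0$ and $\pi^+$ the policy that always plays $y_1$. Write $A^\pi=Q^\pi-V^\pi$ for the advantage function and $\mathbb{A}_{\pi,\mu}(\pi^+)=\mathbb{E}_{x\sim\mu}\mathbb{E}_{y\sim\pi^+(\cdot\mid x)}[A^\pi(x,y)]$ for the policy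 advantage. Then all rewards lie in $[0,R_{\max}]$; the set $\{x:\max_y A^\pi(x,y)\ge\tau\}$ of $\tau$-improvable states is $\{x_1\}$ and has probability $p_\pi$ under $\mu$; and $\pi^+$ is a greedy policy with respect to $\pi$, that is, $y_1\in\arg\max_y A^\pi(x,y)$ for both $x$. For $n\ge 0$ let $(x_i,y_i)_{i=1}^n$ be iid with $x_i\sim\mu$ and, independently of $x_i$, $y_i\sim\mathrm{Unif}(\mathcal{Y})$, and put $$Y_i=|\mathcal{Y}|\bigl(\pi^+(y_i\mid x_i)-\pi(y_i\mid x_i)\bigr)r(x_i,y_i),\qquad \hat{\mathbb{A}}=\frac1n\sum_{i=1}^nY_i,\qquad \sigma^2=\mathrm{Var}(Y_i).$$ There are absolute constants $c_1,a_1,a_2,b_1,b_2>0$ and $C_3\ge1$ (independent of $|\mathcal{Y}|,R_{\max},\tau,\varepsilon,p_\pi$, of the transition kernel and of $n$) such that the following hold. 1. $a_1\,\tau p_\pi\le \mathbb{A}_{\pi,\mu}(\pi^+)\le a_2\,\tau p_\pi$, and $\mathbb{E}[\hat{\mathbb{A}}]=\mathbb{A}_{\pi,\mu}(\pi^+)$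 for every $n\ge1$. 2. $b_1|\mathcal{Y}|R_{\max}^2\le\sigma^2\le b_2|\mathcal{Y}|R_{\max}^2$. 3. For every $n$ with $\displaystyle C_3|\mathcal{Y}|^2\le n\le c_1\frac{|\mathcal{Y}|R_{\max}^2}{\tau^2p_\pi^2}$ we have $\Pr(\hat{\mathbb{A}}\le0)\ge0.18$. Consequently, if $n\ge C_3|\mathcal{Y}|^2$ and $\Pr(\hat{\mathbb{A}}>0)>0.82$, then $n>c_1|\mathcal{Y}|R_{\max}^2/(\tau^2p_\pi^2)$; so, for sample sizes $n\ge C_3|\mathcal{Y}|^2$, the $1/p_\pi^2$ factor is necessary for this estimator to be positive with probability above $0.82$. 4. On the event $\{\hat{\mathbb{A}}\le0\}$ the step size $\hat\alpha=\min\{1,\hat{\mathbb{A}}/(H^2R_{\max})\}$ of CPI with random resets (CPI-RR) is non-positive, hence not a valid mixture coefficient in $(0,1]$. -/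

import Mathlib

open MeasureTheory ProbabilityTheory

/-- A finite-horizon Markov decision process `(X, Y, P, r, H, μ)`. Times are `1, …, H`; the values
of `P` and `r` at other times are never used. -/
structure FiniteHorizonMDP (X Y : Type*) where
  /-- horizon -/
  H : ℕ
  one_le_H : 1 ≤ H
  /-- transition kernels -/
  P : ℕ → X → Y → PMF X
  /-- rewards -/
  r : ℕ → X → Y → ℝ
  /-- initial state distribution -/
  μ : PMF X

/-- A policy: at each time, a map from states to distributions over actions. -/
abbrev Policy (X Y : Type*) := ℕ → X → PMF Y

/-- The deterministic policy that plays `f h x` in state `x` at time `h`. -/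
noncomputable def detPolicy {X Y : Type*} (f : ℕ → X → Y) : Policy X Y :=
  fun h x => PMF.pure (f h x)

/-- Expectation of `f` under a distribution on a finite type. -/
noncomputable def finExpect {α : Type*} [Fintype α] (p : PMF α) (f : α → ℝ) : ℝ :=
  ∑ a, (p a).toReal * f a

namespace FiniteHorizonMDP

variable {X Y : Type*} [Fintype X] [Fintype Y]

/-- The law of the state `x_{h+k}` when `π` is executed from `x_h = x`. -/
noncomputable def stateLaw {X Y : Type*} (M : FiniteHorizonMDP X Y) (π : Policy X Y) (h : ℕ)
    (x : X) : ℕ → PMF X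
  | 0 => PMF.pure x
  | k + 1 => (M.stateLaw π h x k).bind fun x' =>
      (π (h + k) x').bind fun y => M.P (h + k) x' y

/-- The time-`h` state distribution `d_π^h` (`h ≥ 1`), started from `x_1 ∼ μ`. -/
noncomputable def stateDist {X Y : Type*} (M : FiniteHorizonMDP X Y) (π : Policy X Y) (h : ℕ) :
    PMF X :=
  M.μ.bind fun x => M.stateLaw π 1 x (h - 1)

/-- `V_h^π(x) = E_π[∑_{t=h}^H r_t(x_t, y_t) | x_h = x]`; it vanishes at `h = H + 1`. -/
noncomputable def V (M : FiniteHorizonMDP X Y) (π : Policy X Y) (h : ℕ) (x : X) : ℝ :=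
  ∑ t ∈ Finset.Icc h M.H,
    finExpect (M.stateLaw π h x (t - h)) fun x' => finExpect (π t x') fun y => M.r t x' y

/-- `Q_h^π(x, y) = r_h(x, y) + E_{x' ∼ P_h(· | x, y)}[V_{h+1}^π(x')]`. -/
noncomputable def Q (M : FiniteHorizonMDP X Y) (π : Policy X Y) (h : ℕ) (x : X) (y : Y) : ℝ :=
  M.r h x y + finExpect (M.P h x y) (M.V π (h + 1))

/-- The advantage function `A_h^π(x, y) = Q_h^π(x, y) - V_h^π(x)`. -/
noncomputable def adv (M : FiniteHorizonMDP X Y) (π : Policy X Y) (h : ℕ) (x : X) (y : Y) : ℝ :=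
  M.Q π h x y - M.V π h x

/-- The policy advantage
`𝔸_{π,μ}(π') = (1/H) ∑_h E_{x ∼ d_π^h} E_{y ∼ π'_h(· | x)} [A_h^π(x, y)]`. -/
noncomputable def policyAdv (M : FiniteHorizonMDP X Y) (π π' : Policy X Y) : ℝ :=
  (1 / (M.H : ℝ)) * ∑ h ∈ Finset.Icc 1 M.H,
    finExpect (M.stateDist π h) fun x => finExpect (π' h x) fun y => M.adv π h x y

/-- `f` selects a greedy action `f h x ∈ argmax_y A_h^π(x, y)` at all times and states. -/
def IsGreedy (M : FiniteHorizonMDP X Y) (π : Policy X Y) (f : ℕ → X → Y) : Prop :=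
  ∀ h ∈ Finset.Icc 1 M.H, ∀ x y, M.adv π h x y ≤ M.adv π h x (f h x)

/-- The `τ`-improvable set at time `h`: the states with `max_y A_h^π(x, y) ≥ τ`. -/
def improvable (M : FiniteHorizonMDP X Y) (π : Policy X Y) (τ : ℝ) (h : ℕ) : Set X :=
  {x | ∃ y, τ ≤ M.adv π h x y}

/-- The coverage `p_π = (1/H) ∑_h P_{x ∼ d_π^h}[x ∈ G_{h,τ}]`. -/
noncomputable def coverage (M : FiniteHorizonMDP X Y) (π : Policy X Y) (τ : ℝ) : ℝ :=
  (1 / (M.H : ℝ)) * ∑ h ∈ Finset.Icc 1 M.H,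
    ((M.stateDist π h).toOuterMeasure (M.improvable π τ h)).toReal

end FiniteHorizonMDP

/-- The distribution on two states `x₁ = 0`, `x₂ = 1` with masses `p` and `1 - p`. -/
noncomputable def twoPoint (p : ℝ) (hp : 0 ≤ p) (hp1 : p ≤ 1) : PMF (Fin 2) :=
  PMF.ofFintype (fun x => ENNReal.ofReal (if x = 0 then p else 1 - p)) (by
    rw [Fin.sum_univ_two]
    simp only [if_true, one_ne_zero, if_false]
    rw [← ENNReal.ofReal_add hp (by linarith)]
    simp)

/-- The one-step MDP with states `x₁ = 0`, `x₂ = 1`, actions `y₀, …, y_{K-1}` and rewards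
`Rmax/2` for every action other than `y₁`, `r(x₁, y₁) = Rmax/2 + τ`, `r(x₂, y₁) = Rmax/2 + ε`.
The kernels `P` play no role since `H = 1`. -/
noncomputable def tightMDP (K : ℕ) [NeZero K] (P : ℕ → Fin 2 → Fin K → PMF (Fin 2))
    (Rmax τ ε p : ℝ) (hp : 0 ≤ p) (hp1 : p ≤ 1) : FiniteHorizonMDP (Fin 2) (Fin K) where
  H := 1
  one_le_H := le_rfl
  P := P
  r := fun _ x y => if y = 1 then Rmax / 2 + (if x = 0 then τ else ε) else Rmax / 2
  μ := twoPoint p hp hp1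

section Estimator

variable {X Y Ω : Type*} [Fintype Y] {n : ℕ}

/-- `Z i = (x_i, y_i)` are iid with `x_i ∼ μ` and, independently, `y_i ∼ Unif(Y)`. -/
structure IsRandomResetSample [Nonempty Y] [MeasurableSpace X] [MeasurableSpace Y]
    [MeasurableSpace Ω] (M : FiniteHorizonMDP X Y) (Pr : Measure Ω) (Z : Fin n → Ω → X × Y) :
    Prop where
  indep : iIndepFun Z Pr
  law : ∀ i, HasLaw (Z i) (M.μ.toMeasure.prod (PMF.uniformOfFintype Y).toMeasure) Pr

/-- The per-sample term `|Y| (π⁺(y | x) - π(y | x)) r(x, y)` of a one-step problem. -/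
noncomputable def sampleTerm (M : FiniteHorizonMDP X Y) (π π' : Policy X Y) (z : X × Y) : ℝ :=
  (Fintype.card Y : ℝ) * ((π' 1 z.1 z.2).toReal - (π 1 z.1 z.2).toReal) * M.r 1 z.1 z.2

/-- The random-reset empirical advantage `(1/n) ∑ᵢ Yᵢ`. -/
noncomputable def advEstimate (M : FiniteHorizonMDP X Y) (π π' : Policy X Y)
    (Z : Fin n → Ω → X × Y) (ω : Ω) : ℝ :=
  (1 / (n : ℝ)) * ∑ i, sampleTerm M π π' (Z i ω)

/-- The CPI-RR step size `min{1, Â / (H² Rmax)}` computed from the estimate `Â = a`. -/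
noncomputable def stepSize {X Y : Type*} (M : FiniteHorizonMDP X Y) (Rmax a : ℝ) : ℝ :=
  min 1 (a / ((M.H : ℝ) ^ 2 * Rmax))

end Estimator

/-! Each sample term is `K` times `Rmax / 2 * actionSign + rewardGap`. The sign is `±1` with
probability `1 / K` each, whatever the state, so it is symmetric noise; the gap is nonnegative and
carries the whole policy advantage `m = p * τ + (1 - p) * ε`, which lies between `τ * p` and `2 * (τ
* p)`.

Put `q ^ 2 = n / K`. The sum of the signs has standard deviation of order `q`, so the noise has size
`Rmax * q`, while the gaps sum to `q ^ 2 * m` on average. If `q * τ * p` is much smaller than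
`Rmax`, which is the upper bound on `n`, then the noise dominates and the estimate is negative with
constant probability.

No Berry–Esseen bound is needed. The sum of the signs has the explicit real characteristic function
`(1 - 2 / K * (1 - cos u)) ^ n`, so it is symmetric, and smallness of this function at `u = 4 / q`
forces mass at least 0.22 below `-q / 10` (`le_measureReal_Iic_neg_of_charFun`,
`one_sub_mul_one_sub_cos_pow_le`). Markov's inequality makes the gaps compensate with probability at
most 0.04, and 0.22 - 0.04 = 0.18. -/

open scoped ComplexConjugate

/-! ### Tail lower bounds from characteristic functions -/

/-- A lower bound on two-sided tails in terms of the characteristic function. -/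
theorem le_measureReal_abs_ge_of_charFun (ν : Measure ℝ) [IsProbabilityMeasure ν] (u t : ℝ)
    (ht : 0 ≤ t) :
    (1 - (charFun ν u).re) / 2 - (u * t) ^ 2 / 4 ≤ ν.real {x | t ≤ |x|} := by
  have hcos : Integrable (fun x : ℝ => Real.cos (u * x)) ν := by
    refine Integrable.of_bound (by fun_prop) 1 (ae_of_all _ fun x => ?_)
    simpa using Real.abs_cos_le_one (u * x)
  have hre : (charFun ν u).re = ∫ x, Real.cos (u * x) ∂ν := by
    rw [charFun_apply_real, ← RCLike.re_eq_complex_re, ← integral_re]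
    · refine integral_congr_ae (ae_of_all _ fun x => ?_)
      simp only [RCLike.re_eq_complex_re]
      rw [← Complex.ofReal_mul, Complex.exp_ofReal_mul_I_re]
    · refine Integrable.of_bound (by fun_prop) 1 (ae_of_all _ fun x => ?_)
      rw [← Complex.ofReal_mul, Complex.norm_exp_ofReal_mul_I]
  have hS : MeasurableSet {x : ℝ | t ≤ |x|} := measurableSet_le measurable_const measurable_abs
  have hind : Integrable ({x : ℝ | t ≤ |x|}.indicator (fun _ => (2 : ℝ))) ν :=
    (integrable_const _).indicator hS
  -- On the tail `1 - cos ≤ 2`; off it `1 - cos (u * x) ≤ (u * x) ^ 2 / 2 ≤ (u * t) ^ 2 / 2`.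
  have hle : ∫ x, (1 - Real.cos (u * x)) ∂ν ≤
      ∫ x, ({x : ℝ | t ≤ |x|}.indicator (fun _ => (2 : ℝ)) x + (u * t) ^ 2 / 2) ∂ν := by
    refine integral_mono ((integrable_const _).sub hcos) (hind.add (integrable_const _))
      fun x => ?_
    by_cases hx : t ≤ |x|
    · have h1 := Real.neg_one_le_cos (u * x)
      have h2 : 0 ≤ (u * t) ^ 2 / 2 := by positivity
      simp only [Set.indicator_of_mem (show x ∈ {x : ℝ | t ≤ |x|} from hx)]
      linarith
    · have h1 := Real.one_sub_sq_div_two_le_cos (x := u * x)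
      have h2 : x ^ 2 ≤ t ^ 2 := sq_le_sq.2 (by rw [abs_of_nonneg ht]; exact (not_le.1 hx).le)
      have h3 : (u * x) ^ 2 ≤ (u * t) ^ 2 := by
        rw [mul_pow, mul_pow]; exact mul_le_mul_of_nonneg_left h2 (sq_nonneg u)
      simp only [Set.indicator_of_notMem (show x ∉ {x : ℝ | t ≤ |x|} from hx)]
      linarith
  rw [integral_sub (integrable_const _) hcos, integral_add hind (integrable_const _),
    integral_indicator_const _ hS, ← hre] at hle
  simp only [integral_const, probReal_univ, smul_eq_mul, one_mul] at hle
  linarith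

/-- A probability measure on `ℝ` with real characteristic function is symmetric. -/
theorem map_neg_eq_of_conj_charFun {ν : Measure ℝ} [IsProbabilityMeasure ν]
    (h : ∀ u, conj (charFun ν u) = charFun ν u) : ν.map (fun x => -x) = ν := by
  have : IsProbabilityMeasure (ν.map fun x : ℝ => -x) :=
    Measure.isProbabilityMeasure_map measurable_neg.aemeasurable
  refine Measure.ext_of_charFun (funext fun u => ?_)
  have h1 : (fun x : ℝ => -x) = fun x => (-1 : ℝ) * x := by ext; ring
  rw [h1, charFun_map_mul, neg_one_mul, charFun_neg, h]

/-- A lower bound on the lower tail of a symmetric distribution. -/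
theorem le_measureReal_Iic_neg_of_charFun (ν : Measure ℝ) [IsProbabilityMeasure ν]
    (h : ∀ u, conj (charFun ν u) = charFun ν u) (u t : ℝ) (ht : 0 ≤ t) :
    (1 - (charFun ν u).re) / 4 - (u * t) ^ 2 / 8 ≤ ν.real (Set.Iic (-t)) := by
  have h1 := le_measureReal_abs_ge_of_charFun ν u t ht
  have h2 : {x : ℝ | t ≤ |x|} = Set.Iic (-t) ∪ Set.Ici t := by
    ext x
    simp only [Set.mem_ofPred_eq, le_abs, Set.mem_union, Set.mem_Iic, Set.mem_Ici]
    constructor <;> rintro (h | h) <;> first | (left; linarith) | (right; linarith)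
  -- By symmetry both tails have equal mass, so the two-sided bound is halved.
  have h3 : ν.real (Set.Ici t) = ν.real (Set.Iic (-t)) := by
    conv_lhs => rw [← map_neg_eq_of_conj_charFun h]
    rw [map_measureReal_apply measurable_neg measurableSet_Ici]
    congr 1
    ext x
    simp only [Set.mem_preimage, Set.mem_Ici, Set.mem_Iic]
    constructor <;> intro h <;> linarith
  have h4 := measureReal_union_le (μ := ν) (Set.Iic (-t)) (Set.Ici t)
  rw [h2] at h1
  linarith

/-! ### One-step advantages -/

theorem finExpect_pure {α : Type*} [Fintype α] (a : α) (f : α → ℝ) :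
    finExpect (PMF.pure a) f = f a := by
  classical
  unfold finExpect
  rw [Finset.sum_eq_single a]
  · simp
  · intro b _ hb
    simp [PMF.pure_apply, hb]
  · simp

theorem finExpect_zero {α : Type*} [Fintype α] (q : PMF α) : finExpect q (fun _ => 0) = 0 := by
  simp [finExpect]

namespace FiniteHorizonMDP

variable {X Y : Type*} [Fintype X] [Fintype Y]

theorem stateDist_one {X Y : Type*} (M : FiniteHorizonMDP X Y) (π : Policy X Y) :
    M.stateDist π 1 = M.μ := by
  simp [stateDist, stateLaw]

/-- The value at time 2 is an empty sum, so the transition kernel drops out. -/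
theorem adv_one_detPolicy (M : FiniteHorizonMDP X Y) (hH : M.H = 1) (f : ℕ → X → Y) (x : X)
    (y : Y) : M.adv (detPolicy f) 1 x y = M.r 1 x y - M.r 1 x (f 1 x) := by
  have h2 : M.V (detPolicy f) 2 = fun _ => 0 := by ext; simp [V, hH]
  simp [adv, Q, h2, finExpect_zero]
  simp [V, hH, stateLaw, finExpect_pure, detPolicy]

end FiniteHorizonMDP

/-! ### Integration against the sampling law -/

theorem Fin.zero_ne_one_of_two_le {K : ℕ} [NeZero K] (hK : 2 ≤ K) : (0 : Fin K) ≠ 1 := by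
  intro h
  have := congrArg Fin.val h
  rw [Fin.val_zero, Fin.val_one', Nat.mod_eq_of_lt (by omega)] at this
  omega

theorem Fin.sum_eq_of_forall_ne {K : ℕ} [NeZero K] (hK : 2 ≤ K) {E : Type*} [CommRing E]
    (F : Fin K → E) (c : E) (hF : ∀ y, y ≠ 0 → y ≠ 1 → F y = c) :
    ∑ y, F y = F 0 + F 1 + (K - 2) * c := by
  have h01 := Fin.zero_ne_one_of_two_le hK
  have h : ∑ y, (F y - c) = (F 0 - c) + (F 1 - c) := by
    rw [← Finset.sum_pair (f := fun y => F y - c) h01]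
    symm
    refine Finset.sum_subset (Finset.subset_univ _) fun y _ hy => ?_
    simp only [Finset.mem_insert, Finset.mem_singleton, not_or] at hy
    rw [hF y hy.1 hy.2, sub_self]
  rw [Finset.sum_sub_distrib] at h
  simp only [Finset.sum_const, Finset.card_univ, Fintype.card_fin, nsmul_eq_mul] at h
  linear_combination h

theorem twoPoint_toReal (p : ℝ) (hp : 0 ≤ p) (hp1 : p ≤ 1) (x : Fin 2) :
    (twoPoint p hp hp1 x).toReal = if x = 0 then p else 1 - p := by
  simp only [twoPoint, PMF.ofFintype_apply]
  rw [ENNReal.toReal_ofReal]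
  split_ifs <;> linarith

/-- Actions other than `y₀`, `y₁` contribute a common constant. Allowing real and complex values
covers both the moments and the characteristic function. -/
theorem integral_twoPoint_prod_uniform {K : ℕ} [NeZero K] (hK : 2 ≤ K) {p : ℝ} (hp : 0 ≤ p)
    (hp1 : p ≤ 1) {E : Type*} [RCLike E] (f : Fin 2 × Fin K → E) (c : E)
    (hf : ∀ x y, y ≠ 0 → y ≠ 1 → f (x, y) = c) :
    ∫ z, f z ∂((twoPoint p hp hp1).toMeasure.prod (PMF.uniformOfFintype (Fin K)).toMeasure) =
      c + (p * (f (0, 0) + f (0, 1) - 2 * c) + (1 - p) * (f (1, 0) + f (1, 1) - 2 * c)) / K := by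
  have hK0 : (K : E) ≠ 0 := by exact_mod_cast (by omega : K ≠ 0)
  rw [integral_prod _ .of_finite]
  simp only [PMF.integral_eq_sum, PMF.uniformOfFintype_apply, Fintype.card_fin,
    ENNReal.toReal_inv, ENNReal.toReal_natCast, ← Finset.smul_sum]
  simp only [Fin.sum_univ_two, twoPoint_toReal, if_true, one_ne_zero, if_false]
  rw [Fin.sum_eq_of_forall_ne hK (fun y => f (0, y)) c (hf 0),
    Fin.sum_eq_of_forall_ne hK (fun y => f (1, y)) c (hf 1)]
  simp only [RCLike.real_smul_eq_coe_mul]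
  push_cast
  field_simp
  ring

/-- The sign of an action: `1` for `y₁`, `-1` for `y₀`, `0` otherwise. -/
noncomputable def actionSign {X : Type*} {K : ℕ} [NeZero K] (z : X × Fin K) : ℝ :=
  if z.2 = 1 then 1 else if z.2 = 0 then -1 else 0

/-- The reward excess `τ` or `ε` of the action `y₁`. -/
noncomputable def rewardGap {K : ℕ} [NeZero K] (τ ε : ℝ) (z : Fin 2 × Fin K) : ℝ :=
  if z.2 = 1 then (if z.1 = 0 then τ else ε) else 0

/-! ### The two-state instance -/

section TightMDP

variable {K : ℕ} [NeZero K] {P : ℕ → Fin 2 → Fin K → PMF (Fin 2)} {Rmax τ ε p : ℝ}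
  {hp : 0 ≤ p} {hp1 : p ≤ 1}

theorem tightMDP_reward_mem_Icc (hτ : 0 < τ) (hτR : τ ≤ Rmax / 2) (hε : 0 ≤ ε) (hετ : ε < τ)
    (x : Fin 2) (y : Fin K) :
    (tightMDP K P Rmax τ ε p hp hp1).r 1 x y ∈ Set.Icc 0 Rmax := by
  simp only [tightMDP, Set.mem_Icc]
  constructor <;> split_ifs <;> linarith

theorem tightMDP_adv (hK : 2 ≤ K) (x : Fin 2) (y : Fin K) :
    (tightMDP K P Rmax τ ε p hp hp1).adv (detPolicy fun _ _ => 0) 1 x y =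
      rewardGap τ ε (x, y) := by
  rw [FiniteHorizonMDP.adv_one_detPolicy _ rfl]
  simp only [tightMDP, rewardGap, Fin.zero_ne_one_of_two_le hK, if_false]
  split_ifs <;> ring

theorem tightMDP_improvable (hK : 2 ≤ K) (hτ : 0 < τ) (hετ : ε < τ) :
    (tightMDP K P Rmax τ ε p hp hp1).improvable (detPolicy fun _ _ => 0) τ 1 = {0} := by
  ext x
  simp only [FiniteHorizonMDP.improvable, tightMDP_adv hK, Set.mem_ofPred_eq,
    Set.mem_singleton_iff, rewardGap]
  constructor
  · rintro ⟨y, hy⟩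
    by_contra hx
    rw [if_neg hx] at hy
    split_ifs at hy <;> linarith
  · rintro rfl
    exact ⟨1, by simp⟩

theorem tightMDP_coverage (hK : 2 ≤ K) (hτ : 0 < τ) (hετ : ε < τ) :
    (tightMDP K P Rmax τ ε p hp hp1).coverage (detPolicy fun _ _ => 0) τ = p := by
  have hH : (tightMDP K P Rmax τ ε p hp hp1).H = 1 := rfl
  simp only [FiniteHorizonMDP.coverage, hH, Finset.Icc_self, Finset.sum_singleton,
    FiniteHorizonMDP.stateDist_one, tightMDP_improvable hK hτ hετ]
  rw [PMF.toOuterMeasure_apply_singleton]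
  have := twoPoint_toReal p hp hp1 0
  simpa [tightMDP] using this

theorem tightMDP_isGreedy (hK : 2 ≤ K) (hτ : 0 < τ) (hε : 0 ≤ ε) :
    (tightMDP K P Rmax τ ε p hp hp1).IsGreedy (detPolicy fun _ _ => 0) (fun _ _ => 1) := by
  intro h hh x y
  have hH : (tightMDP K P Rmax τ ε p hp hp1).H = 1 := rfl
  rw [hH, Finset.Icc_self, Finset.mem_singleton] at hh
  subst hh
  rw [tightMDP_adv hK, tightMDP_adv hK]
  simp only [rewardGap, if_true]
  split_ifs <;> linarith

theorem tightMDP_policyAdv (hK : 2 ≤ K) :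
    (tightMDP K P Rmax τ ε p hp hp1).policyAdv (detPolicy fun _ _ => 0) (detPolicy fun _ _ => 1) =
      p * τ + (1 - p) * ε := by
  have hH : (tightMDP K P Rmax τ ε p hp hp1).H = 1 := rfl
  have hμ : (tightMDP K P Rmax τ ε p hp hp1).μ = twoPoint p hp hp1 := rfl
  have hd : ∀ x, (detPolicy (fun _ _ => 1) : Policy (Fin 2) (Fin K)) 1 x = PMF.pure 1 :=
    fun _ => rfl
  simp only [FiniteHorizonMDP.policyAdv, hH, Finset.Icc_self, Finset.sum_singleton,
    FiniteHorizonMDP.stateDist_one, hμ, hd, finExpect_pure, tightMDP_adv hK]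
  simp [finExpect, twoPoint_toReal, rewardGap]

/-- The baseline reward `Rmax / 2` produces the symmetric noise, and the excess reward of `y₁`
produces the drift. -/
theorem tightMDP_sampleTerm (hK : 2 ≤ K) (z : Fin 2 × Fin K) :
    sampleTerm (tightMDP K P Rmax τ ε p hp hp1) (detPolicy fun _ _ => 0) (detPolicy fun _ _ => 1)
      z = K * (Rmax / 2 * actionSign z + rewardGap τ ε z) := by
  have h01 := Fin.zero_ne_one_of_two_le hK
  obtain ⟨x, y⟩ := z
  simp only [sampleTerm, detPolicy, tightMDP, actionSign, rewardGap, PMF.pure_apply,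
    Fintype.card_fin]
  by_cases h1 : y = 1
  · subst h1
    simp [h01.symm]
  · by_cases h0 : y = 0
    · subst h0
      simp [h01]
    · simp [h0, h1]

end TightMDP

/-! ### Moments and characteristic function of the samples -/

section Sample

variable {K : ℕ} [NeZero K] {P : ℕ → Fin 2 → Fin K → PMF (Fin 2)} {Rmax τ ε p : ℝ}
  {hp : 0 ≤ p} {hp1 : p ≤ 1} {Ω : Type*} [MeasurableSpace Ω] {Pr : Measure Ω} {n : ℕ}
  {Z : Fin n → Ω → Fin 2 × Fin K}

theorem IsRandomResetSample.integral_comp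
    (hZ : IsRandomResetSample (tightMDP K P Rmax τ ε p hp hp1) Pr Z) (hK : 2 ≤ K) (i : Fin n)
    {E : Type*} [RCLike E] (f : Fin 2 × Fin K → E) (c : E)
    (hf : ∀ x y, y ≠ 0 → y ≠ 1 → f (x, y) = c) :
    ∫ ω, f (Z i ω) ∂Pr =
      c + (p * (f (0, 0) + f (0, 1) - 2 * c) + (1 - p) * (f (1, 0) + f (1, 1) - 2 * c)) / K := by
  rw [← integral_twoPoint_prod_uniform hK hp hp1 f c hf]
  exact (hZ.law i).integral_comp (measurable_of_finite f).aestronglyMeasurable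

theorem IsRandomResetSample.aemeasurable_comp
    (hZ : IsRandomResetSample (tightMDP K P Rmax τ ε p hp hp1) Pr Z) (i : Fin n)
    {E : Type*} [MeasurableSpace E] (f : Fin 2 × Fin K → E) :
    AEMeasurable (fun ω => f (Z i ω)) Pr :=
  (measurable_of_finite f).comp_aemeasurable (hZ.law i).aemeasurable

theorem IsRandomResetSample.memLp_comp [IsProbabilityMeasure Pr]
    (hZ : IsRandomResetSample (tightMDP K P Rmax τ ε p hp hp1) Pr Z) (i : Fin n)
    (f : Fin 2 × Fin K → ℝ) (q : ENNReal) : MemLp (fun ω => f (Z i ω)) q Pr :=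
  MemLp.of_bound (hZ.aemeasurable_comp i f).aestronglyMeasurable (∑ z, ‖f z‖)
    (ae_of_all _ fun ω =>
      Finset.single_le_sum (f := fun z => ‖f z‖) (fun _ _ => norm_nonneg _)
        (Finset.mem_univ (Z i ω)))

theorem IsRandomResetSample.integrable_comp [IsProbabilityMeasure Pr]
    (hZ : IsRandomResetSample (tightMDP K P Rmax τ ε p hp hp1) Pr Z) (i : Fin n)
    (f : Fin 2 × Fin K → ℝ) : Integrable (fun ω => f (Z i ω)) Pr :=
  memLp_one_iff_integrable.1 (hZ.memLp_comp i f 1)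

theorem IsRandomResetSample.integral_rewardGap
    (hZ : IsRandomResetSample (tightMDP K P Rmax τ ε p hp hp1) Pr Z) (hK : 2 ≤ K) (i : Fin n) :
    ∫ ω, rewardGap τ ε (Z i ω) ∂Pr = (p * τ + (1 - p) * ε) / K := by
  rw [hZ.integral_comp hK i (rewardGap τ ε) 0 (fun x y _ h1 => by simp [rewardGap, h1])]
  simp [rewardGap, Fin.zero_ne_one_of_two_le hK]

theorem IsRandomResetSample.integral_sampleTerm
    (hZ : IsRandomResetSample (tightMDP K P Rmax τ ε p hp hp1) Pr Z) (hK : 2 ≤ K) (i : Fin n) :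
    ∫ ω, sampleTerm (tightMDP K P Rmax τ ε p hp hp1) (detPolicy fun _ _ => 0)
      (detPolicy fun _ _ => 1) (Z i ω) ∂Pr = p * τ + (1 - p) * ε := by
  have hK0 : (K : ℝ) ≠ 0 := by exact_mod_cast (by omega : K ≠ 0)
  simp only [tightMDP_sampleTerm hK]
  rw [hZ.integral_comp hK i (fun z => (K : ℝ) * (Rmax / 2 * actionSign z + rewardGap τ ε z)) 0
    (fun x y h0 h1 => by simp [rewardGap, actionSign, h1, h0])]
  simp [rewardGap, actionSign, Fin.zero_ne_one_of_two_le hK]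
  field_simp
  ring

theorem IsRandomResetSample.variance_sampleTerm [IsProbabilityMeasure Pr]
    (hZ : IsRandomResetSample (tightMDP K P Rmax τ ε p hp hp1) Pr Z) (hK : 2 ≤ K) (i : Fin n) :
    variance (fun ω => sampleTerm (tightMDP K P Rmax τ ε p hp hp1) (detPolicy fun _ _ => 0)
      (detPolicy fun _ _ => 1) (Z i ω)) Pr =
      K * ((Rmax / 2) ^ 2 + p * (Rmax / 2 + τ) ^ 2 + (1 - p) * (Rmax / 2 + ε) ^ 2) -
        (p * τ + (1 - p) * ε) ^ 2 := by
  have hK0 : (K : ℝ) ≠ 0 := by exact_mod_cast (by omega : K ≠ 0)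
  rw [variance_eq_sub (hZ.memLp_comp i _ 2), hZ.integral_sampleTerm hK i]
  congr 1
  simp only [Pi.pow_apply, tightMDP_sampleTerm hK]
  rw [hZ.integral_comp hK i
    (fun z => ((K : ℝ) * (Rmax / 2 * actionSign z + rewardGap τ ε z)) ^ 2) 0
    (fun x y h0 h1 => by simp [rewardGap, actionSign, h1, h0])]
  simp [rewardGap, actionSign, Fin.zero_ne_one_of_two_le hK]
  field_simp
  ring

/-- The values `1` and `-1` have equal probability `1 / K`, so the exponentials combine into a
cosine. -/
theorem IsRandomResetSample.charFun_actionSign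
    (hZ : IsRandomResetSample (tightMDP K P Rmax τ ε p hp hp1) Pr Z) (hK : 2 ≤ K) (i : Fin n)
    (u : ℝ) :
    charFun (Pr.map fun ω => actionSign (Z i ω)) u =
      ((1 - 2 / K * (1 - Real.cos u) : ℝ) : ℂ) := by
  rw [charFun_apply_real, integral_map (hZ.aemeasurable_comp i _) (by fun_prop)]
  rw [hZ.integral_comp hK i (fun z => Complex.exp (u * actionSign z * Complex.I)) 1
    (fun x y h0 h1 => by simp [actionSign, h1, h0])]
  simp only [actionSign, Fin.zero_ne_one_of_two_le hK, if_true, if_false]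
  push_cast
  rw [Complex.cos]
  simp
  ring

theorem IsRandomResetSample.charFun_sum_actionSign [IsProbabilityMeasure Pr]
    (hZ : IsRandomResetSample (tightMDP K P Rmax τ ε p hp hp1) Pr Z) (hK : 2 ≤ K) (u : ℝ) :
    charFun (Pr.map fun ω => ∑ i, actionSign (Z i ω)) u =
      (((1 - 2 / K * (1 - Real.cos u)) ^ n : ℝ) : ℂ) := by
  have hind : iIndepFun (fun i ω => actionSign (Z i ω)) Pr :=
    hZ.indep.comp (fun _ => actionSign) (fun _ => measurable_of_finite _)
  rw [hind.charFun_map_fun_sum_eq_prod (fun i => hZ.aemeasurable_comp i _), Finset.prod_apply]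
  simp [hZ.charFun_actionSign hK]

end Sample

/-! ### Decay of the characteristic function -/

/-- The characteristic function of the sum of `n` action signs is small at frequency `4 / q`, where
`q ^ 2 = n / K`. -/
theorem one_sub_mul_one_sub_cos_pow_le {K n : ℕ} (hK : 2 ≤ K) (hn : 8 * (K : ℝ) ^ 2 ≤ n) {q : ℝ} (hq : 0 < q)
    (hqn : q ^ 2 * K = n) : (1 - 2 / K * (1 - Real.cos (4 / q))) ^ n ≤ 1 / 64 := by
  have hK2 : (2 : ℝ) ≤ K := by exact_mod_cast hK
  have hK0 : (0 : ℝ) < K := by linarith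
  have hq16 : 16 ≤ q ^ 2 := by
    have h1 : 8 * (K : ℝ) * K ≤ q ^ 2 * K := by rw [hqn]; linarith [sq (K : ℝ)]
    have := le_of_mul_le_mul_right h1 hK0
    linarith
  have hq4 : 4 ≤ q := by nlinarith
  have hu0 : 0 < 4 / q := by positivity
  have hu1 : 4 / q ≤ 1 := by rw [div_le_one hq]; exact hq4
  have hcos0 : 0 ≤ Real.cos (4 / q) :=
    Real.cos_nonneg_of_mem_Icc ⟨by linarith [Real.pi_gt_three], by linarith [Real.pi_gt_three]⟩
  have hcos : Real.cos (4 / q) ≤ 1 - 2 / Real.pi ^ 2 * (4 / q) ^ 2 :=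
    Real.cos_le_one_sub_mul_cos_sq (by rw [abs_of_pos hu0]; linarith [Real.pi_gt_three])
  have hpi : Real.pi ^ 2 ≤ 10 := by nlinarith [Real.pi_lt_d2, Real.pi_pos]
  have hpi' : (1 : ℝ) / 5 ≤ 2 / Real.pi ^ 2 := by
    rw [div_le_div_iff₀ (by norm_num) (by positivity)]; linarith
  have hgap : 16 / 5 / q ^ 2 ≤ 1 - Real.cos (4 / q) := by
    have := mul_le_mul_of_nonneg_right hpi' (sq_nonneg (4 / q))
    have h2 : (1 : ℝ) / 5 * (4 / q) ^ 2 = 16 / 5 / q ^ 2 := by field_simp; norm_num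
    linarith
  have hbase : 0 ≤ 1 - 2 / (K : ℝ) * (1 - Real.cos (4 / q)) := by
    have h1 : 2 / (K : ℝ) ≤ 1 := by rw [div_le_one hK0]; exact hK2
    have h2 : 0 ≤ 1 - Real.cos (4 / q) := by linarith [Real.cos_le_one (4 / q)]
    nlinarith
  -- Since `n = q ^ 2 * K`, the factors `q` and `K` cancel and leave 32/5.
  have hexp : (6 : ℝ) ≤ n * (2 / K * (1 - Real.cos (4 / q))) := by
    have h1 : (n : ℝ) * (2 / K * (16 / 5 / q ^ 2)) = 32 / 5 := by
      rw [← hqn]; field_simp; norm_num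
    have h2 : (n : ℝ) * (2 / K * (16 / 5 / q ^ 2)) ≤ n * (2 / K * (1 - Real.cos (4 / q))) := by
      gcongr
    linarith
  calc (1 - 2 / (K : ℝ) * (1 - Real.cos (4 / q))) ^ n
      ≤ Real.exp (-(2 / K * (1 - Real.cos (4 / q)))) ^ n :=
        pow_le_pow_left₀ hbase (Real.one_sub_le_exp_neg _) n
    _ = Real.exp (-(n * (2 / K * (1 - Real.cos (4 / q))))) := by
        rw [← Real.exp_nat_mul]; congr 1; ring
    _ ≤ Real.exp (-6) := Real.exp_le_exp.2 (by linarith)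
    _ ≤ 1 / 64 := by
        have h1 : Real.exp 6 = Real.exp 1 ^ 6 := by rw [← Real.exp_nat_mul]; norm_num
        have h2 : (2 : ℝ) ^ 6 ≤ Real.exp 1 ^ 6 := by
          gcongr
          linarith [Real.add_one_le_exp (1 : ℝ)]
        rw [Real.exp_neg, h1, ← one_div]
        exact one_div_le_one_div_of_le (by norm_num) (by linarith)

/-! ### Noise against drift -/

section Tail

variable {K : ℕ} [NeZero K] {P : ℕ → Fin 2 → Fin K → PMF (Fin 2)} {Rmax τ ε p : ℝ}
  {hp : 0 ≤ p} {hp1 : p ≤ 1} {Ω : Type*} [MeasurableSpace Ω] {Pr : Measure Ω} {n : ℕ}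
  {Z : Fin n → Ω → Fin 2 × Fin K}

theorem IsRandomResetSample.le_measureReal_sum_actionSign [IsProbabilityMeasure Pr]
    (hZ : IsRandomResetSample (tightMDP K P Rmax τ ε p hp hp1) Pr Z) (hK : 2 ≤ K)
    (hn : 8 * (K : ℝ) ^ 2 ≤ n) {q : ℝ} (hq : 0 < q) (hqn : q ^ 2 * K = n) :
    0.22 ≤ Pr.real {ω | ∑ i, actionSign (Z i ω) ≤ -(q / 10)} := by
  have hW : AEMeasurable (fun ω => ∑ i, actionSign (Z i ω)) Pr :=
    Finset.aemeasurable_fun_sum _ fun i _ => hZ.aemeasurable_comp i _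
  have : IsProbabilityMeasure (Pr.map fun ω => ∑ i, actionSign (Z i ω)) :=
    Measure.isProbabilityMeasure_map hW
  -- The bound becomes `(1 - 1/64) / 4 - (4/25) / 8`, which exceeds 0.22.
  have h := le_measureReal_Iic_neg_of_charFun (Pr.map fun ω => ∑ i, actionSign (Z i ω))
    (fun u => by rw [hZ.charFun_sum_actionSign hK, Complex.conj_ofReal]) (4 / q) (q / 10)
    (by positivity)
  rw [hZ.charFun_sum_actionSign hK, Complex.ofReal_re, map_measureReal_apply_of_aemeasurable hW
    measurableSet_Iic] at h
  have h1 := one_sub_mul_one_sub_cos_pow_le hK hn hq hqn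
  have h2 : (4 / q * (q / 10)) ^ 2 = 4 / 25 := by field_simp; norm_num
  rw [h2] at h
  refine le_trans ?_ h
  norm_num at h1 ⊢
  linarith

theorem IsRandomResetSample.measureReal_sum_rewardGap_le [IsProbabilityMeasure Pr]
    (hZ : IsRandomResetSample (tightMDP K P Rmax τ ε p hp hp1) Pr Z) (hK : 2 ≤ K)
    (hτ : 0 ≤ τ) (hε : 0 ≤ ε) {t : ℝ} :
    t * Pr.real {ω | t ≤ ∑ i, rewardGap τ ε (Z i ω)} ≤ n * ((p * τ + (1 - p) * ε) / K) := by
  have h0 : ∀ z : Fin 2 × Fin K, 0 ≤ rewardGap τ ε z := fun z => by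
    unfold rewardGap; split_ifs <;> linarith
  refine (mul_meas_ge_le_integral_of_nonneg
    (ae_of_all _ fun ω => Finset.sum_nonneg fun i _ => h0 (Z i ω))
    (integrable_finsetSum _ fun i _ => hZ.integrable_comp i _) t).trans_eq ?_
  rw [integral_finsetSum _ fun i _ => hZ.integrable_comp i _]
  simp [hZ.integral_rewardGap hK]

theorem IsRandomResetSample.le_measureReal_advEstimate_nonpos [IsProbabilityMeasure Pr]
    (hZ : IsRandomResetSample (tightMDP K P Rmax τ ε p hp hp1) Pr Z) (hK : 2 ≤ K)
    (hp0 : 0 < p) (hτ : 0 < τ) (hτR : τ ≤ Rmax / 2) (hε : 0 ≤ ε) (hεp : (1 - p) * ε ≤ τ * p)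
    (hn : 8 * (K : ℝ) ^ 2 ≤ n)
    (hn' : (n : ℝ) ≤ 1 / 10 ^ 6 * (K * Rmax ^ 2 / (τ ^ 2 * p ^ 2))) :
    0.18 ≤ Pr.real {ω | advEstimate (tightMDP K P Rmax τ ε p hp hp1) (detPolicy fun _ _ => 0)
      (detPolicy fun _ _ => 1) Z ω ≤ 0} := by
  have hK0 : (0 : ℝ) < K := by exact_mod_cast (by omega : 0 < K)
  have hn0 : (0 : ℝ) < n := lt_of_lt_of_le (by positivity) hn
  have hR : 0 < Rmax := by linarith
  set q : ℝ := Real.sqrt (n / K) with hqdef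
  have hq : 0 < q := Real.sqrt_pos.2 (by positivity)
  have hqn : q ^ 2 * K = n := by
    rw [hqdef, Real.sq_sqrt (by positivity)]; field_simp
  have hsign := hZ.le_measureReal_sum_actionSign hK hn hq hqn
  have hgap := hZ.measureReal_sum_rewardGap_le hK hτ.le hε (t := Rmax * q / 20)
  -- Square root of the upper bound on `n`; 1000 is the root of `10 ^ 6`.
  have hqR : q * (τ * p) ≤ Rmax / 1000 := by
    refine le_of_sq_le_sq ?_ (by positivity)
    have h1 : (1 : ℝ) / 10 ^ 6 * (K * Rmax ^ 2 / (τ ^ 2 * p ^ 2)) * (τ ^ 2 * p ^ 2) =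
        1 / 10 ^ 6 * (K * Rmax ^ 2) := by field_simp
    have h2 := mul_le_mul_of_nonneg_right hn' (by positivity : 0 ≤ τ ^ 2 * p ^ 2)
    rw [h1, ← hqn] at h2
    refine le_of_mul_le_mul_right ?_ hK0
    calc (q * (τ * p)) ^ 2 * K = q ^ 2 * K * (τ ^ 2 * p ^ 2) := by ring
      _ ≤ 1 / 10 ^ 6 * (K * Rmax ^ 2) := h2
      _ = (Rmax / 1000) ^ 2 * K := by ring
  -- Markov at `Rmax * q / 20`, with mean at most `2 * q ^ 2 * τ * p`, gives `40 * q * τ * p / Rmax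
  -- ≤ 0.04`.
  have hgap' : Pr.real {ω | Rmax * q / 20 ≤ ∑ i, rewardGap τ ε (Z i ω)} ≤ 0.04 := by
    have h1 : (n : ℝ) * ((p * τ + (1 - p) * ε) / K) = q ^ 2 * (p * τ + (1 - p) * ε) := by
      rw [← hqn]; field_simp
    have h2 : q ^ 2 * (p * τ + (1 - p) * ε) ≤ q ^ 2 * (2 * (τ * p)) := by
      gcongr; linarith
    have h3 : q * (2 * (q * (τ * p))) ≤ q * (2 * (Rmax / 1000)) := by gcongr
    refine le_of_mul_le_mul_left ?_ (by positivity : 0 < Rmax * q / 20)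
    norm_num
    linarith
  -- Signs summing to at most `-q / 10` contribute at most `-(Rmax * q / 20)`, so a positive
  -- estimate needs gaps above that threshold.
  have hsub : {ω | ∑ i, actionSign (Z i ω) ≤ -(q / 10)} ⊆
      {ω | advEstimate (tightMDP K P Rmax τ ε p hp hp1) (detPolicy fun _ _ => 0)
        (detPolicy fun _ _ => 1) Z ω ≤ 0} ∪
      {ω | Rmax * q / 20 ≤ ∑ i, rewardGap τ ε (Z i ω)} := by
    intro ω hω
    by_cases h : Rmax * q / 20 ≤ ∑ i, rewardGap τ ε (Z i ω)
    · exact Or.inr h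
    · left
      replace hω : ∑ i, actionSign (Z i ω) ≤ -(q / 10) := hω
      have h1 := mul_le_mul_of_nonneg_left hω (by positivity : 0 ≤ Rmax / 2)
      simp only [Set.mem_ofPred_eq, advEstimate, tightMDP_sampleTerm hK, ← Finset.mul_sum,
        Finset.sum_add_distrib]
      refine mul_nonpos_of_nonneg_of_nonpos (by positivity)
        (mul_nonpos_of_nonneg_of_nonpos hK0.le ?_)
      linarith
  have hun := (measureReal_mono (μ := Pr) hsub).trans (measureReal_union_le _ _)
  norm_num at hsign hgap' ⊢
  linarith

/-- The samples are only almost everywhere measurable, so the complement rule is used for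
null-measurable sets. -/
theorem IsRandomResetSample.measureReal_advEstimate_nonpos_add_pos [IsProbabilityMeasure Pr]
    (hZ : IsRandomResetSample (tightMDP K P Rmax τ ε p hp hp1) Pr Z) (π π' : Policy _ _) :
    Pr.real {ω | advEstimate (tightMDP K P Rmax τ ε p hp hp1) π π' Z ω ≤ 0} +
      Pr.real {ω | 0 < advEstimate (tightMDP K P Rmax τ ε p hp hp1) π π' Z ω} = 1 := by
  have hA : AEMeasurable (advEstimate (tightMDP K P Rmax τ ε p hp hp1) π π' Z) Pr :=
    (Finset.aemeasurable_fun_sum _ fun i _ => hZ.aemeasurable_comp i _).const_mul _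
  have h := probReal_compl_eq_one_sub₀ (μ := Pr) (hA.nullMeasurable measurableSet_Iic :
    NullMeasurableSet (advEstimate (tightMDP K P Rmax τ ε p hp hp1) π π' Z ⁻¹' Set.Iic 0) Pr)
  have h1 : (advEstimate (tightMDP K P Rmax τ ε p hp hp1) π π' Z ⁻¹' Set.Iic 0)ᶜ =
      {ω | 0 < advEstimate (tightMDP K P Rmax τ ε p hp hp1) π π' Z ω} := by
    ext ω; simp
  rw [h1] at h
  rw [h]
  exact add_sub_cancel _ _

theorem IsRandomResetSample.integral_advEstimate [IsProbabilityMeasure Pr]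
    (hZ : IsRandomResetSample (tightMDP K P Rmax τ ε p hp hp1) Pr Z) (hK : 2 ≤ K) (hn : 1 ≤ n) :
    ∫ ω, advEstimate (tightMDP K P Rmax τ ε p hp hp1) (detPolicy fun _ _ => 0)
      (detPolicy fun _ _ => 1) Z ω ∂Pr = p * τ + (1 - p) * ε := by
  have hn0 : (n : ℝ) ≠ 0 := by exact_mod_cast (by omega : n ≠ 0)
  simp only [advEstimate]
  rw [integral_const_mul, integral_finsetSum _ fun i _ => hZ.integrable_comp i _]
  simp only [hZ.integral_sampleTerm hK, Finset.sum_const, Finset.card_univ, Fintype.card_fin,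
    nsmul_eq_mul]
  field_simp

end Tail

/-! ### Assembly with explicit constants -/

theorem mainTheorem2 :
    ∃ c₁ C₃ a₁ a₂ b₁ b₂ : ℝ, 0 < c₁ ∧ 1 ≤ C₃ ∧ 0 < a₁ ∧ 0 < a₂ ∧ 0 < b₁ ∧ 0 < b₂ ∧
      ∀ (K : ℕ) [NeZero K] (_hK : 2 ≤ K) (P : ℕ → Fin 2 → Fin K → PMF (Fin 2))
        (Rmax τ ε p : ℝ) (hp : 0 < p) (hp1 : p ≤ 1) (_hτ : 0 < τ) (_hτR : τ ≤ Rmax / 2)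
        (_hε : 0 ≤ ε) (_hετ : ε < τ) (_hεp : (1 - p) * ε ≤ τ * p)
        (M : FiniteHorizonMDP (Fin 2) (Fin K)) (_hM : M = tightMDP K P Rmax τ ε p hp.le hp1)
        (π πplus : Policy (Fin 2) (Fin K))
        (_hπ : π = detPolicy fun _ _ => 0) (_hπplus : πplus = detPolicy fun _ _ => 1),
        -- structure of the construction
        (∀ x y, M.r 1 x y ∈ Set.Icc 0 Rmax) ∧
        M.improvable π τ 1 = {0} ∧ M.coverage π τ = p ∧ M.IsGreedy π (fun _ _ => 1) ∧
        -- the policy advantage is of order `τ p`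
        a₁ * (τ * p) ≤ M.policyAdv π πplus ∧ M.policyAdv π πplus ≤ a₂ * (τ * p) ∧
        ∀ (Ω : Type*) [MeasurableSpace Ω] (Pr : Measure Ω) [IsProbabilityMeasure Pr]
          (n : ℕ) (Z : Fin n → Ω → Fin 2 × Fin K) (_hZ : IsRandomResetSample M Pr Z),
          -- mean of the estimator
          (1 ≤ n → ∫ ω, advEstimate M π πplus Z ω ∂Pr = M.policyAdv π πplus) ∧
          -- variance of each term
          (∀ i, b₁ * (K * Rmax ^ 2) ≤ variance (fun ω => sampleTerm M π πplus (Z i ω)) Pr ∧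
            variance (fun ω => sampleTerm M π πplus (Z i ω)) Pr ≤ b₂ * (K * Rmax ^ 2)) ∧
          -- the estimate fails to be positive
          (C₃ * (K : ℝ) ^ 2 ≤ n → (n : ℝ) ≤ c₁ * (K * Rmax ^ 2 / (τ ^ 2 * p ^ 2)) →
            0.18 ≤ Pr.real {ω | advEstimate M π πplus Z ω ≤ 0}) ∧
          -- sample size needed for the estimate to be positive with probability above `0.82`
          (C₃ * (K : ℝ) ^ 2 ≤ n → 0.82 < Pr.real {ω | 0 < advEstimate M π πplus Z ω} →
            c₁ * (K * Rmax ^ 2 / (τ ^ 2 * p ^ 2)) < n) ∧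
          -- the step size is then not a valid mixture coefficient
          (∀ ω, advEstimate M π πplus Z ω ≤ 0 →
            stepSize M Rmax (advEstimate M π πplus Z ω) ≤ 0 ∧
            stepSize M Rmax (advEstimate M π πplus Z ω) ∉ Set.Ioc (0 : ℝ) 1) := by

  refine ⟨1 / 10 ^ 6, 8, 1, 2, 1 / 4, 5 / 4, by norm_num, by norm_num, by norm_num, by norm_num,
    by norm_num, by norm_num, ?_⟩
  rintro K _ hK P Rmax τ ε p hp hp1 hτ hτR hε hετ hεp M rfl π πplus rfl rfl
  have hR : 0 < Rmax := by linarith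
  have hK2 : (2 : ℝ) ≤ K := by exact_mod_cast hK
  have hp1' : 0 ≤ 1 - p := by linarith
  have hεp0 : 0 ≤ (1 - p) * ε := mul_nonneg hp1' hε
  refine ⟨tightMDP_reward_mem_Icc hτ hτR hε hετ, tightMDP_improvable hK hτ hετ,
    tightMDP_coverage hK hτ hετ, tightMDP_isGreedy hK hτ hε, ?_, ?_, ?_⟩
  · rw [tightMDP_policyAdv hK]; linarith
  · rw [tightMDP_policyAdv hK]; linarith
  intro Ω _ Pr _ n Z hZ
  have hnonpos := fun h h' =>
    hZ.le_measureReal_advEstimate_nonpos hK hp hτ hτR hε hεp (n := n) h h'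
  refine ⟨fun hn => ?_, fun i => ?_, hnonpos, fun hn hpos => ?_, fun ω hω => ?_⟩
  · rw [hZ.integral_advEstimate hK hn, tightMDP_policyAdv hK]
  · rw [hZ.variance_sampleTerm hK i, add_assoc]
    -- By Jensen the subtracted squared mean is at most `A`, the average of `(Rmax / 2 + gap) ^ 2`
    -- over states. Since `K ≥ 1`, the variance is at least `K * (Rmax / 2) ^ 2`, giving 1/4; `A ≤
    -- Rmax ^ 2` gives 5/4.
    have hjensen : (p * τ + (1 - p) * ε) ^ 2 ≤ p * τ ^ 2 + (1 - p) * ε ^ 2 := by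
      nlinarith [mul_nonneg (mul_nonneg hp.le hp1') (sq_nonneg (τ - ε))]
    have h1 : p * τ ^ 2 + (1 - p) * ε ^ 2 ≤
        p * (Rmax / 2 + τ) ^ 2 + (1 - p) * (Rmax / 2 + ε) ^ 2 := by
      gcongr <;> linarith
    have h2 : p * (Rmax / 2 + τ) ^ 2 + (1 - p) * (Rmax / 2 + ε) ^ 2 ≤ Rmax ^ 2 := by
      calc _ ≤ p * Rmax ^ 2 + (1 - p) * Rmax ^ 2 := by gcongr <;> linarith
        _ = Rmax ^ 2 := by ring
    have h3 : 0 ≤ p * τ ^ 2 + (1 - p) * ε ^ 2 := by positivity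
    generalize p * (Rmax / 2 + τ) ^ 2 + (1 - p) * (Rmax / 2 + ε) ^ 2 = A at *
    constructor
    · nlinarith
    · nlinarith [sq_nonneg (p * τ + (1 - p) * ε)]
  · by_contra! hle
    have h1 := hnonpos hn hle
    have h2 := hZ.measureReal_advEstimate_nonpos_add_pos (detPolicy fun _ _ => 0)
      (detPolicy fun _ _ => 1)
    norm_num at h1 hpos
    linarith
  · have hle : stepSize (tightMDP K P Rmax τ ε p hp.le hp1) Rmax (advEstimate
        (tightMDP K P Rmax τ ε p hp.le hp1) (detPolicy fun _ _ => 0) (detPolicy fun _ _ => 1)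
        Z ω) ≤ 0 := by
      refine (min_le_right _ _).trans (div_nonpos_of_nonpos_of_nonneg hω ?_)
      positivity
    exact ⟨hle, fun h => absurd h.1 (not_lt.2 hle)⟩
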